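/- Let $q$ be a prime power, $k=\mathbb F_q(T)$, and let $K/k$ be a Kummer extension of exponent $n\mid q-1$, i.e. a finite abelian extension such that $\operatorname{Gal}(K/k)$ has exponent $n$, where $n\mid q-1$. Let $\infty$ be the infinite prime of $k$ (the one with uniformizer $1/T$) and $k_\infty$ the completion of $k$ at $\infty$. For a prime $\mathfrak p$ of $K$ let $K_{\mathfrak p}$ be the completion of $K$ at $\mathfrak p$; write $\mathfrak p\mid\infty$ if $\mathfrak p$ lies above $\infty$ and $\mathfrak p\nmid\infty$ otherwise, and for $\mathfrak p\nmid\infty$ let $U_{\mathfrak p}$ be the group of units of the valuation ring of $K_{\mathfrak p}$. Put $$\Delta=\Big\{(\alpha_{\mathfrak p})_{\mathfrak p\mid\infty}\in\prod_{\mathfrak p\mid\infty}K_{\mathfrak p}^*\ \Big|\ \prod_{\mathfrak p\mid\infty}\operatorname{N}_{K_{\mathfrak p}/k_\infty}(\alpha_{\mathfrak p})\in k_\infty^{*n}\Big\},$$ where $k_\infty^{*n}$ is the group of $n$-th powers of elements of $k_\infty^*$. Let $J_K$ be the idèle group of $K$, and embed $K^*$ in it diagonally. Then the subgroup $K^*\big(\Delta\times\prod_{\mathfrak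 p\nmid\infty}U_{\mathfrak p}\big)$ has finite index in $J_K$. -/

import Mathlib

/-! Places, adeles and ideles of a finite separable extension `K` of `k = 𝔽_q(T)`. The field `k` is
`RatFunc Fq`, its infinite prime is Mathlib's `RatFunc.inftyValuation Fq` (`v(f / g) = deg f - deg g`,
written multiplicatively), and `k_∞` is Mathlib's `RatFunc.CompletionAtInfty Fq`. -/

open IsDedekindDomain
open scoped Polynomial

noncomputable section

namespace KummerFF

section Places

variable (Fq : Type*) [Field Fq] [DecidableEq (RatFunc Fq)]

/-- The valuation ring of the infinite prime of `k = Fq(T)`. -/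
abbrev inftyIntegers : ValuationSubring (RatFunc Fq) :=
  (RatFunc.inftyValuation Fq).valuationSubring

variable (K : Type*) [Field K] [Algebra (RatFunc Fq) K]

/-- The integral closure in `K` of the valuation ring of the infinite prime of `k`. -/
abbrev inftyClosure : Subalgebra (inftyIntegers Fq) K :=
  integralClosure (inftyIntegers Fq) K

/-- The infinite primes of `K`, i.e. those above the infinite prime of `k`: they correspond to the
nonzero prime ideals of the integral closure in `K` of the valuation ring of the infinite prime. -/
abbrev InfinitePrime : Type _ := HeightOneSpectrum (inftyClosure Fq K)

variable [FunctionField Fq K] [Algebra.IsSeparable (RatFunc Fq) K]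

instance : IsDedekindDomain (inftyClosure Fq K) :=
  IsIntegralClosure.isDedekindDomain (inftyIntegers Fq) (RatFunc Fq) K _

instance : IsFractionRing (inftyClosure Fq K) K :=
  integralClosure.isFractionRing_of_finite_extension (RatFunc Fq) K

instance : Module.Finite (inftyIntegers Fq) (inftyClosure Fq K) :=
  IsIntegralClosure.finite (inftyIntegers Fq) (RatFunc Fq) K _

variable {Fq K} in
theorem comap_asIdeal (v : InfinitePrime Fq K) :
    v.asIdeal.comap (algebraMap (inftyIntegers Fq) (inftyClosure Fq K)) =
      IsLocalRing.maximalIdeal (inftyIntegers Fq) := by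
  have hm : v.asIdeal.IsMaximal := v.isMaximal
  exact IsLocalRing.eq_maximalIdeal (Ideal.isMaximal_comap_of_isIntegral_of_isMaximal v.asIdeal)

instance : Finite (InfinitePrime Fq K) := by
  have hf := Algebra.QuasiFinite.finite_primesOver (S := inftyClosure Fq K)
    (IsLocalRing.maximalIdeal (inftyIntegers Fq))
  have := hf.to_subtype
  refine Finite.of_injective (fun v : InfinitePrime Fq K =>
    (⟨v.asIdeal, v.isPrime, ⟨(comap_asIdeal v).symm⟩⟩ :
      (IsLocalRing.maximalIdeal (inftyIntegers Fq)).primesOver (inftyClosure Fq K))) ?_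
  intro v w h
  exact HeightOneSpectrum.ext (congrArg Subtype.val h)

instance : Fintype (InfinitePrime Fq K) := Fintype.ofFinite _

variable {Fq K}

/-- The completion `K_𝔭` of `K` at an infinite prime `𝔭`. -/
abbrev InfinitePrime.Completion (v : InfinitePrime Fq K) : Type _ := v.adicCompletion K

/-- The embedding `k → K → K_𝔭`. -/
def baseHom (v : InfinitePrime Fq K) : RatFunc Fq →+* v.Completion :=
  (algebraMap K v.Completion).comp (algebraMap (RatFunc Fq) K)

theorem valued_baseHom (v : InfinitePrime Fq K) (f : RatFunc Fq) :
    Valued.v (baseHom v f) = v.valuation K (algebraMap (RatFunc Fq) K f) :=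
  v.valuedAdicCompletion_eq_valuation' _

theorem valued_baseHom_le_one (v : InfinitePrime Fq K) {f : RatFunc Fq}
    (hf : RatFunc.inftyValuation Fq f ≤ 1) : Valued.v (baseHom v f) ≤ 1 := by
  rw [valued_baseHom]
  exact v.valuation_le_one
    (algebraMap (inftyIntegers Fq) (inftyClosure Fq K) ⟨f, hf⟩)

theorem valued_baseHom_lt_one (v : InfinitePrime Fq K) {f : RatFunc Fq}
    (hf : RatFunc.inftyValuation Fq f < 1) : Valued.v (baseHom v f) < 1 := by
  rw [valued_baseHom]
  refine (v.valuation_lt_one_iff_mem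
    (algebraMap (inftyIntegers Fq) (inftyClosure Fq K) ⟨f, hf.le⟩)).2 ?_
  rw [← Ideal.mem_comap, comap_asIdeal]
  rw [IsLocalRing.mem_maximalIdeal, mem_nonunits_iff]
  intro hu
  have := (Valuation.integer.integers
    (RatFunc.inftyValuation Fq)).isUnit_iff_valuation_eq_one.1 hu
  exact hf.ne this

/-- `k → K_𝔭` is continuous for the topology of the infinite prime of `k`. -/
theorem continuous_baseHom (v : InfinitePrime Fq K) :
    @Continuous _ _ (RatFunc.inftyValued Fq).toUniformSpace.toTopologicalSpace _ (baseHom v) := by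
  let : Valued (RatFunc Fq) (WithZero (Multiplicative ℤ)) := RatFunc.inftyValued Fq
  change Continuous (baseHom v)
  refine continuous_of_continuousAt_zero (baseHom v) ?_
  rw [ContinuousAt, map_zero]
  intro s hs
  obtain ⟨γ, hγ⟩ := Valued.mem_nhds_zero.1 hs
  set t : RatFunc Fq := 1 / RatFunc.X with ht
  have ht0 : t ≠ 0 := one_div_ne_zero RatFunc.X_ne_zero
  have htlt : RatFunc.inftyValuation Fq t < 1 := by
    rw [ht, RatFunc.inftyValuation.X_inv, ← WithZero.exp_zero, WithZero.exp_lt_exp]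
    norm_num
  have hγ0 : MonoidWithZeroHom.ValueGroup₀.embedding γ.1 ≠ 0 := by simp
  obtain ⟨m, hm⟩ := exists_pow_lt₀ (valued_baseHom_lt_one v htlt) (Units.mk0 _ hγ0)
  rw [Filter.mem_map, Valued.mem_nhds_zero]
  have hr0 : (Valued.v : Valuation (RatFunc Fq) _).restrict (t ^ m) ≠ 0 := by
    simpa using fun h : t = 0 => absurd h ht0
  refine ⟨Units.mk0 _ hr0, fun f hf => hγ ?_⟩
  simp only [Set.mem_ofPred_eq, Units.val_mk0, Valuation.restrict_lt_iff] at hf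
  rw [Set.mem_ofPred_eq, Valuation.restrict_lt_iff_lt_embedding]
  refine lt_of_le_of_lt ?_ hm
  have hle : RatFunc.inftyValuation Fq (f / t ^ m) ≤ 1 := by
    rw [map_div₀]
    exact div_le_one_of_le₀ hf.le zero_le
  have h1 := valued_baseHom_le_one v hle
  have h2 : f = f / t ^ m * t ^ m := by field_simp
  rw [h2, map_mul, map_mul, map_pow, map_pow]
  exact mul_le_of_le_one_left' h1

/-- The embedding `k_∞ → K_𝔭`, extending `k → K_𝔭` by continuity. -/
def completionHom (v : InfinitePrime Fq K) : RatFunc.CompletionAtInfty Fq →+* v.Completion :=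
  letI : Valued (RatFunc Fq) (WithZero (Multiplicative ℤ)) := RatFunc.inftyValued Fq
  UniformSpace.Completion.extensionHom (baseHom v) (continuous_baseHom v)

theorem completionHom_coe (v : InfinitePrime Fq K) (f : RatFunc Fq) :
    completionHom v (algebraMap (RatFunc Fq) (RatFunc.CompletionAtInfty Fq) f) =
      algebraMap K v.Completion (algebraMap (RatFunc Fq) K f) := by
  let : Valued (RatFunc Fq) (WithZero (Multiplicative ℤ)) := RatFunc.inftyValued Fq
  exact UniformSpace.Completion.extensionHom_coe (baseHom v) (continuous_baseHom v) f

instance (v : InfinitePrime Fq K) : Algebra (RatFunc.CompletionAtInfty Fq) v.Completion :=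
  (completionHom v).toAlgebra

/-- The local norm `N_{K_𝔭 / k_∞} : K_𝔭ˣ → k_∞ˣ`. -/
def localNorm (v : InfinitePrime Fq K) : v.Completionˣ →* (RatFunc.CompletionAtInfty Fq)ˣ :=
  Units.map (Algebra.norm (RatFunc.CompletionAtInfty Fq))

variable (Fq K)

/-- The homomorphism `(α_𝔭) ↦ ∏_{𝔭 ∣ ∞} N_{K_𝔭 / k_∞} (α_𝔭)`. -/
def prodLocalNorm :
    ((v : InfinitePrime Fq K) → v.Completionˣ) →* (RatFunc.CompletionAtInfty Fq)ˣ where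
  toFun α := ∏ v : InfinitePrime Fq K, localNorm v (α v)
  map_one' := by simp
  map_mul' α β := by simp [Finset.prod_mul_distrib]

/-- The group `Δ` of the `(α_𝔭)` in `∏_{𝔭 ∣ ∞} K_𝔭ˣ` for which `∏_{𝔭 ∣ ∞} N_{K_𝔭 / k_∞} (α_𝔭)` is
an `n`-th power in `k_∞ˣ`. -/
def Δ (n : ℕ) : Subgroup ((v : InfinitePrime Fq K) → v.Completionˣ) :=
  (powMonoidHom n : (RatFunc.CompletionAtInfty Fq)ˣ →* _).range.comap (prodLocalNorm Fq K)

variable [Algebra Fq[X] K] [IsScalarTower Fq[X] (RatFunc Fq) K]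

/-- The finite primes of `K`: the nonzero prime ideals of the integral closure of `Fq[T]`. -/
abbrev FinitePrime : Type _ := HeightOneSpectrum (FunctionField.ringOfIntegers Fq K)

/-- The adele ring of `K`: the restricted product of the completions of `K` at all its primes,
with respect to the valuation rings at the finite primes. (There are only finitely many infinite
primes, so no condition is needed there.) -/
abbrev AdeleRing : Type _ :=
  ((v : InfinitePrime Fq K) → v.Completion) ×
    FiniteAdeleRing (FunctionField.ringOfIntegers Fq K) K

/-- The idele group `J_K` of `K`. -/
abbrev IdeleGroup : Type _ := (AdeleRing Fq K)ˣ

/-- `Kˣ`, embedded diagonally in `J_K`. -/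
def principalIdeles : Subgroup (IdeleGroup Fq K) :=
  (Units.map (algebraMap K (AdeleRing Fq K)).toMonoidHom).range

/-- The components of an idele at the infinite primes. -/
def infiniteComponents : IdeleGroup Fq K →* ((v : InfinitePrime Fq K) → v.Completionˣ) :=
  MulEquiv.piUnits.toMonoidHom.comp (Units.map (MonoidHom.fst _ _))

variable {Fq K} in
/-- The component of an idele at the finite prime `𝔭`. -/
def finiteComponent (v : FinitePrime Fq K) : IdeleGroup Fq K →* (v.adicCompletion K)ˣ :=
  Units.map
    { toFun := fun a => a.2 v
      map_one' := rfl
      map_mul' := fun _ _ => rfl }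

/-- The group `Δ × ∏_{𝔭 ∤ ∞} U_𝔭` of ideles, `U_𝔭` being the units of the valuation ring of `K_𝔭`. -/
def deltaUnits (n : ℕ) : Subgroup (IdeleGroup Fq K) :=
  (Δ Fq K n).comap (infiniteComponents Fq K) ⊓
    ⨅ v : FinitePrime Fq K, (v.adicCompletionIntegers K).unitGroup.comap (finiteComponent v)

end Places

end KummerFF

end

namespace KummerFF

/-! ### Powers in the completion at infinity -/

section LocalPowers

open Filter Topology WithZero

/-! Let `P` be the principal ideles, `W` the ideles that are units at all finite primes, and `D ≤ W`
the subgroup cut out by `Δ`. Then `[J : PD] = [J : PW] [PW : PD]`, and two finiteness facts bound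
the factors. Sending an idele to the ideal class of its finite part has kernel inside `PW`, so `[J :
PW]` divides the order of the class group of the ring of integers, finite because `Fq` is
(`ker_ideleClass_le`). The factor `[PW : PD]` divides `[W : D]`, and the product of local norms
embeds `W / D` in `k_∞ˣ` modulo `n`-th powers. That quotient is finite
(`finiteIndex_range_powMonoidHom`): an element of `k_∞ˣ` is a power of `T` times a constant times a
one-unit, and one-units are `n`-th powers because `n ∣ q - 1`. -/

theorem nonarchimedeanAddGroup_of_valued (L : Type*) {Γ₀ : Type*} [Ring L]
    [LinearOrderedCommGroupWithZero Γ₀] [Valued L Γ₀] : NonarchimedeanAddGroup L where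
  is_nonarchimedean s hs := by
    obtain ⟨γ, hγ⟩ := (Valued.is_topological_valuation s).1 hs
    exact ⟨⟨(Valued.v : Valuation L Γ₀).restrict.ltAddSubgroup γ, Valued.isOpen_ball L γ.1⟩, hγ⟩

/-- In a complete valued field of characteristic `p`, a one-unit `u` is an `n`-th power for every
`n ∣ p ^ f - 1`: it is the limit of the powers `u ^ (1 - p ^ (f * m))` of `u ^ n`. -/
theorem exists_pow_eq_of_valued_sub_one_lt {L Γ₀ : Type*} [Field L]
    [LinearOrderedCommGroupWithZero Γ₀] [MulArchimedean Γ₀] [Valued L Γ₀] [CompleteSpace L]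
    (p f n : ℕ) [ExpChar L p] (hq : 1 < p ^ f) (hn : n ∣ p ^ f - 1)
    {u : L} (hu : Valued.v (u - 1) < 1) : ∃ w : L, w ^ n = u := by
  obtain ⟨d, hd⟩ := hn
  have hv1 : Valued.v u = 1 := by
    simpa using Valuation.map_one_add_of_lt (v := Valued.v) hu
  have hu0 : u ≠ 0 := by
    rintro rfl
    simp at hv1
  -- Passing to the inverse keeps all exponents below natural numbers.
  set y := u⁻¹ with hy
  have hvy : Valued.v y = 1 := by simp [hy, hv1]
  have hy1 : Valued.v (y - 1) < 1 := by
    have : y - 1 = -(y * (u - 1)) := by rw [hy]; field_simp; ring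
    rw [this, Valuation.map_neg, map_mul, hvy, one_mul]
    exact hu
  have hsmall {z : L} (hz : Valued.v z < 1) :
      Tendsto (fun m : ℕ => z ^ p ^ (f * m)) atTop (𝓝 0) := by
    refine (Valued.tendsto_zero_pow_of_v_lt_one hz).comp ?_
    simp only [pow_mul]
    exact tendsto_pow_atTop_atTop_of_one_lt hq
  have hyd : Valued.v (y ^ d - 1) < 1 := by
    rw [← mul_geom_sum, map_mul]
    refine mul_lt_one_of_lt_of_le hy1 (Valuation.map_sum_le _ fun i _ => ?_)
    simp [hvy]
  -- With `q = p ^ f` and `n * d = q - 1`, the total exponent of `y` is `d * (1 + q + ... + q ^ (m -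
  -- 1)) = (q ^ m - 1) / n`.
  let w : ℕ → L := fun m => ∏ i ∈ Finset.range m, (y ^ d) ^ p ^ (f * i)
  have hw1 (m : ℕ) : Valued.v (w m) = 1 := by simp [w, map_prod, hvy]
  have hwn (m : ℕ) : w m ^ n * y = y ^ p ^ (f * m) := by
    induction m with
    | zero => simp [w]
    | succ m ih =>
      have hstep : w (m + 1) = w m * (y ^ d) ^ p ^ (f * m) := Finset.prod_range_succ _ _
      have he : p ^ (f * (m + 1)) = p ^ (f * m) + d * p ^ (f * m) * n := by
        obtain ⟨r, hr⟩ := Nat.exists_eq_add_of_lt hq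
        have : p ^ f = 1 + n * d := by omega
        rw [mul_add, pow_add, mul_one, this]
        ring
      rw [hstep, mul_pow, mul_right_comm, ih, he, pow_add, ← pow_mul, ← pow_mul, ← mul_assoc]
  have hcauchy : CauchySeq w := by
    have := nonarchimedeanAddGroup_of_valued L
    refine NonarchimedeanAddGroup.cauchySeq_of_tendsto_sub_nhds_zero ?_
    -- Frobenius turns `y ^ (d * q ^ m) - 1` into a `q ^ m`-th power of an element of valuation
    -- below 1. In a nonarchimedean group, successive differences tending to 0 already give a Cauchy
    -- sequence.
    have hdiff (m : ℕ) : w (m + 1) - w m = w m * (y ^ d - 1) ^ p ^ (f * m) := by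
      rw [sub_pow_expChar_pow, one_pow, mul_sub, mul_one]
      congr 1
      exact Finset.prod_range_succ _ _
    have h0 := hsmall hyd
    rw [(Valued.hasBasis_nhds_zero L Γ₀).tendsto_right_iff] at h0 ⊢
    intro γ hγ
    filter_upwards [h0 γ hγ] with m hm
    rw [Valuation.restrict_lt_iff_lt_embedding] at hm ⊢
    rwa [hdiff, map_mul, hw1, one_mul]
  obtain ⟨l, hl⟩ := cauchySeq_tendsto_of_complete hcauchy
  refine ⟨l, ?_⟩
  have h1 : Tendsto (fun m => w m ^ n * y) atTop (𝓝 (l ^ n * y)) :=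
    (hl.pow n).mul tendsto_const_nhds
  have h2 : Tendsto (fun m => w m ^ n * y) atTop (𝓝 1) := by
    have := (hsmall hy1).add_const 1
    simpa [hwn, sub_pow_expChar_pow] using this
  have h3 := tendsto_nhds_unique h1 h2
  rwa [hy, mul_inv_eq_one₀ hu0] at h3

variable (F : Type*) [Field F] [DecidableEq (RatFunc F)]

instance : CompleteSpace (RatFunc.CompletionAtInfty F) :=
  letI : Valued (RatFunc F) (WithZero (Multiplicative ℤ)) := RatFunc.inftyValued F
  inferInstanceAs (CompleteSpace (UniformSpace.Completion (RatFunc F)))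

variable {F}

theorem valued_algebraMap_completionAtInfty (f : RatFunc F) :
    Valued.v (algebraMap (RatFunc F) (RatFunc.CompletionAtInfty F) f) =
      RatFunc.inftyValuation F f :=
  letI : Valued (RatFunc F) (WithZero (Multiplicative ℤ)) := RatFunc.inftyValued F
  Valued.valuedCompletion_apply f

theorem exists_valued_sub_algebraMap_lt_one (x : RatFunc.CompletionAtInfty F) :
    ∃ f : RatFunc F,
      Valued.v (x - algebraMap (RatFunc F) (RatFunc.CompletionAtInfty F) f) < 1 := by
  let : Valued (RatFunc F) (WithZero (Multiplicative ℤ)) := RatFunc.inftyValued F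
  have hd : DenseRange (algebraMap (RatFunc F) (RatFunc.CompletionAtInfty F)) :=
    UniformSpace.Completion.denseRange_coe
  have ho : IsOpen {y : RatFunc.CompletionAtInfty F | Valued.v (x - y) < 1} := by
    have := (Valued.isOpen_ball (RatFunc.CompletionAtInfty F) 1).preimage
      (continuous_const.sub continuous_id : Continuous fun y => x - y)
    simpa [Valuation.restrict_lt_one_iff, Set.preimage] using this
  exact hd.exists_mem_open ho ⟨x, by simp⟩

theorem inftyValuation_algebraMap {g : F[X]} (hg : g ≠ 0) :
    RatFunc.inftyValuation F (algebraMap F[X] (RatFunc F) g) = exp (g.natDegree : ℤ) :=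
  RatFunc.inftyValuation.polynomial F hg

/-- The residue field of the infinite prime of `F(T)` is `F`. -/
theorem exists_inftyValuation_sub_C_lt_one {f : RatFunc F} (hf : RatFunc.inftyValuation F f = 1) :
    ∃ c : F, c ≠ 0 ∧ RatFunc.inftyValuation F (f - RatFunc.C c) < 1 := by
  have hf0 : f ≠ 0 := by
    rintro rfl
    simp at hf
  have hg0 : f.num ≠ 0 := RatFunc.num_ne_zero hf0
  have hh0 : f.denom ≠ 0 := f.denom_ne_zero
  have hhe : algebraMap F[X] (RatFunc F) f.denom ≠ 0 := by simpa using hh0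
  have hfe : f = algebraMap F[X] (RatFunc F) f.num / algebraMap F[X] (RatFunc F) f.denom :=
    f.num_div_denom.symm
  have hdeg : f.num.natDegree = f.denom.natDegree := by
    have h := hf
    rw [hfe, map_div₀, inftyValuation_algebraMap hg0, inftyValuation_algebraMap hh0,
      div_eq_one_iff_eq (by simp), exp_inj] at h
    exact_mod_cast h
  -- Numerator and denominator have equal degree, so this `c` is the value of `f` at infinity:
  -- subtracting it cancels the leading terms.
  set c := f.num.leadingCoeff / f.denom.leadingCoeff with hc
  have hc0 : c ≠ 0 := div_ne_zero (by simpa using hg0) (by simpa using hh0)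
  refine ⟨c, hc0, ?_⟩
  set r := f.num - Polynomial.C c * f.denom with hr
  have hfr : f - RatFunc.C c =
      algebraMap F[X] (RatFunc F) r / algebraMap F[X] (RatFunc F) f.denom := by
    rw [hr, map_sub, map_mul, RatFunc.algebraMap_C, sub_div, mul_div_cancel_right₀ _ hhe, ← hfe]
  rw [hfr]
  rcases eq_or_ne r 0 with h0 | h0
  · simp [h0]
  have hlt : r.degree < f.num.degree := by
    refine Polynomial.degree_sub_lt_left ?_ hg0 ?_
    · rw [Polynomial.degree_C_mul hc0, Polynomial.degree_eq_natDegree hg0,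
        Polynomial.degree_eq_natDegree hh0, hdeg]
    · rw [Polynomial.leadingCoeff_mul, Polynomial.leadingCoeff_C, hc,
        div_mul_cancel₀ _ (by simpa using hh0)]
  have hlt' := Polynomial.natDegree_lt_natDegree h0 hlt
  rw [map_div₀, inftyValuation_algebraMap h0, inftyValuation_algebraMap hh0, ← exp_sub,
    ← exp_zero, exp_lt_exp]
  omega

variable (F) in
/-- Every unit of `k_∞` is `T ^ i * c` times a one-unit, with `c` a nonzero constant. -/
theorem exists_eq_X_zpow_mul_C_mul_oneUnit (a : (RatFunc.CompletionAtInfty F)ˣ) :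
    ∃ (i : ℤ) (c : Fˣ) (u : RatFunc.CompletionAtInfty F), Valued.v (u - 1) < 1 ∧
      (a : RatFunc.CompletionAtInfty F) =
        algebraMap _ _ (RatFunc.X : RatFunc F) ^ i * algebraMap _ _ (RatFunc.C (c : F)) * u := by
  set ι := algebraMap (RatFunc F) (RatFunc.CompletionAtInfty F) with hι
  -- `T` has valuation `exp 1`, so `T ^ (-i) * a` has valuation 1.
  set i := log (Valued.v (a : RatFunc.CompletionAtInfty F)) with hi
  have hT0 : ι RatFunc.X ≠ 0 := by simp [RatFunc.X_ne_zero]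
  set b := ι RatFunc.X ^ (-i) * a with hb
  have hvb : Valued.v b = 1 := by
    rw [hb, map_mul, map_zpow₀, hι, valued_algebraMap_completionAtInfty,
      RatFunc.inftyValuation.X, ← exp_zsmul,
      ← exp_log (x := Valued.v (a : RatFunc.CompletionAtInfty F)) (by simp), ← hi, ← exp_add]
    simp
  obtain ⟨f, hf⟩ := exists_valued_sub_algebraMap_lt_one b
  have hvf : RatFunc.inftyValuation F f = 1 := by
    rw [← valued_algebraMap_completionAtInfty, ← hvb]
    refine Valuation.map_eq_of_sub_lt _ ?_
    rw [hvb, Valuation.map_sub_swap]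
    exact hf
  obtain ⟨c, hc0, hc⟩ := exists_inftyValuation_sub_C_lt_one hvf
  have hιc : ι (RatFunc.C c) ≠ 0 := by simpa using hc0
  have hvc : Valued.v (ι (RatFunc.C c)) = 1 := by
    rw [valued_algebraMap_completionAtInfty]
    exact RatFunc.inftyValuation.C F hc0
  refine ⟨i, Units.mk0 c hc0, b / ι (RatFunc.C c), ?_, ?_⟩
  · have h1 : b / ι (RatFunc.C c) - 1 =
        ((b - ι f) + ι (f - RatFunc.C c)) / ι (RatFunc.C c) := by
      rw [map_sub]
      field_simp
      ring
    rw [h1, map_div₀, hvc, div_one]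
    refine Valuation.map_add_lt _ hf ?_
    rw [valued_algebraMap_completionAtInfty]
    exact hc
  · rw [Units.val_mk0, mul_assoc, mul_div_cancel₀ _ hιc, hb, ← mul_assoc, ← zpow_add₀ hT0]
    simp

variable (F) in
/-- If `F` is finite and `n ∣ #F - 1`, then the `n`-th powers have finite index in `k_∞ˣ`. -/
theorem finiteIndex_range_powMonoidHom [Finite F] {n : ℕ} (hn : n ∣ Nat.card F - 1) :
    (powMonoidHom n : (RatFunc.CompletionAtInfty F)ˣ →* _).range.FiniteIndex := by
  have hn0 : n ≠ 0 := by
    rintro rfl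
    have h1 : 1 < Nat.card F := Finite.one_lt_card
    have := Nat.eq_zero_of_zero_dvd hn
    omega
  have : NeZero n := ⟨hn0⟩
  have := Fintype.ofFinite F
  obtain ⟨p, hp, f, hpp, hcard⟩ := FiniteField.card' F
  have : Fact p.Prime := ⟨hpp⟩
  have : CharP (RatFunc.CompletionAtInfty F) p :=
    charP_of_injective_ringHom
      ((algebraMap (RatFunc F) (RatFunc.CompletionAtInfty F)).comp RatFunc.C).injective p
  set ι := algebraMap (RatFunc F) (RatFunc.CompletionAtInfty F) with hι
  let T : (RatFunc.CompletionAtInfty F)ˣ :=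
    Units.mk0 (ι RatFunc.X) (by simp [RatFunc.X_ne_zero])
  let φ : F →* RatFunc.CompletionAtInfty F := (ι.comp RatFunc.C).toMonoidHom
  set H := (powMonoidHom n : (RatFunc.CompletionAtInfty F)ˣ →* _).range with hH
  suffices Finite ((RatFunc.CompletionAtInfty F)ˣ ⧸ H) from Subgroup.finiteIndex_of_finite_quotient
  -- One-units die in the quotient, and the exponent of `T` matters only modulo `n`.
  refine Finite.of_surjective
    (fun x : Fin n × Fˣ => (QuotientGroup.mk (T ^ (x.1 : ℕ) * Units.map φ x.2) :
      (RatFunc.CompletionAtInfty F)ˣ ⧸ H)) fun a => ?_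
  obtain ⟨a, rfl⟩ := QuotientGroup.mk_surjective a
  obtain ⟨i, c, u, hu, ha⟩ := exists_eq_X_zpow_mul_C_mul_oneUnit F a
  rw [Nat.card_eq_fintype_card, hcard] at hn
  obtain ⟨w, hw⟩ := exists_pow_eq_of_valued_sub_one_lt p f n
    (Nat.one_lt_pow f.ne_zero hpp.one_lt) hn hu
  have hw0 : w ≠ 0 := by
    rintro rfl
    rw [zero_pow hn0] at hw
    simp [← hw] at hu
  have hnpos : (0 : ℤ) < n := by exact_mod_cast Nat.pos_of_ne_zero hn0
  have hmod : ((i % n).toNat : ℤ) = i % n := Int.toNat_of_nonneg (Int.emod_nonneg _ hnpos.ne')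
  refine ⟨(⟨(i % n).toNat, ?_⟩, c), ?_⟩
  · have := Int.emod_lt_of_pos i hnpos
    omega
  · refine QuotientGroup.eq.2 ⟨T ^ (i / n) * Units.mk0 w hw0, ?_⟩
    have ha' : a = T ^ i * Units.map φ c * Units.mk0 w hw0 ^ n := by
      ext
      simpa [T, φ, hw] using ha
    have hi : T ^ i = T ^ (i % n).toNat * (T ^ (i / n)) ^ n := by
      rw [← zpow_natCast, ← zpow_natCast, hmod, ← zpow_mul, ← zpow_add, mul_comm (i / n),
        Int.emod_add_mul_ediv]
    rw [powMonoidHom_apply, mul_pow, eq_inv_mul_iff_mul_eq, ha', hi]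
    simp only [mul_assoc, mul_left_comm, mul_comm]

end LocalPowers

/-! ### Finite ideles and fractional ideals -/

section Content

open WithZero
open scoped nonZeroDivisors

variable {R : Type*} [CommRing R] [IsDedekindDomain R] {K : Type*} [Field K] [Algebra R K]
  [IsFractionRing R K]

/-- Links the two descriptions of the order of `x`, so that a generator of the content of an idele
can be compared with the idele prime by prime. -/
theorem log_valuation_eq_neg_count (v : HeightOneSpectrum R) {x : K} (hx : x ≠ 0) :
    log (v.valuation K x) = -FractionalIdeal.count K v (FractionalIdeal.spanSingleton R⁰ x) := by
  classical
  obtain ⟨r, s, rfl⟩ := IsLocalization.exists_mk'_eq R⁰ x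
  have hr : r ≠ 0 := by
    rintro rfl
    simp at hx
  have hs : (s : R) ≠ 0 := nonZeroDivisors.ne_zero s.2
  rw [FractionalIdeal.count_well_defined K v (a := (s : R)) (J := Ideal.span {r}),
    v.valuation_of_mk', v.intValuation_if_neg hr, v.intValuation_if_neg hs, ← exp_sub, log_exp]
  · ring
  · exact FractionalIdeal.spanSingleton_ne_zero_iff.2 hx
  · rw [FractionalIdeal.coeIdeal_span_singleton, FractionalIdeal.spanSingleton_mul_spanSingleton,
      IsFractionRing.mk'_eq_div, div_eq_inv_mul]

theorem eventually_valued_eq_one (a : (FiniteAdeleRing R K)ˣ) :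
    ∀ᶠ v in Filter.cofinite, Valued.v (a.1 v) = 1 :=
  (FiniteAdeleRing.isUnit_iff.1 a.isUnit).2

theorem finiteAdele_unit_apply_ne_zero (a : (FiniteAdeleRing R K)ˣ) (v : HeightOneSpectrum R) :
    a.1 v ≠ 0 :=
  (FiniteAdeleRing.isUnit_iff.1 a.isUnit).1 v

/-- The order of a finite idele at a prime. -/
noncomputable def ord (a : (FiniteAdeleRing R K)ˣ) (v : HeightOneSpectrum R) : ℤ :=
  -log (Valued.v (a.1 v))

theorem eventually_ord_eq_zero (a : (FiniteAdeleRing R K)ˣ) :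
    ∀ᶠ v in Filter.cofinite, ord a v = 0 := by
  filter_upwards [eventually_valued_eq_one a] with v hv
  simp [ord, hv]

theorem ord_mul (a b : (FiniteAdeleRing R K)ˣ) (v : HeightOneSpectrum R) :
    ord (a * b) v = ord a v + ord b v := by
  have h : (a * b).1 v = a.1 v * b.1 v := rfl
  rw [ord, h, map_mul, log_mul (by simpa using finiteAdele_unit_apply_ne_zero a v)
    (by simpa using finiteAdele_unit_apply_ne_zero b v), ord, ord]
  ring

theorem hasFiniteMulSupport_zpow_ord (a : (FiniteAdeleRing R K)ˣ) :
    Function.HasFiniteMulSupport fun v : HeightOneSpectrum R =>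
      (v.asIdeal : FractionalIdeal R⁰ K) ^ ord a v := by
  refine (Filter.eventually_cofinite.1 (eventually_ord_eq_zero a)).subset fun v hv h => hv ?_
  simp [h]

/-- The fractional ideal `∏ 𝔭 ^ ord_𝔭(a)` of a finite idele `a`. -/
noncomputable def content : (FiniteAdeleRing R K)ˣ →* (FractionalIdeal R⁰ K)ˣ :=
  -- The source is a group, so multiplicativity alone makes the values invertible.
  MonoidHom.toHomUnits
    { toFun a := ∏ᶠ v : HeightOneSpectrum R, (v.asIdeal : FractionalIdeal R⁰ K) ^ ord a v
      map_one' := by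
        refine finprod_eq_one_of_forall_eq_one fun v => ?_
        have h : (1 : (FiniteAdeleRing R K)ˣ).1 v = (1 : v.adicCompletion K) := rfl
        rw [ord, h, map_one, log_one, neg_zero, zpow_zero]
      map_mul' a b := by
        rw [← finprod_mul_distrib (hasFiniteMulSupport_zpow_ord a) (hasFiniteMulSupport_zpow_ord b)]
        refine finprod_congr fun v => ?_
        rw [ord_mul, zpow_add₀ (FractionalIdeal.coeIdeal_ne_zero.2 v.ne_bot)] }

theorem count_content (a : (FiniteAdeleRing R K)ˣ) (v : HeightOneSpectrum R) :
    FractionalIdeal.count K v (content a : FractionalIdeal R⁰ K) = ord a v :=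
  FractionalIdeal.count_finprod K v _ (eventually_ord_eq_zero a)

/-- If the content of a finite idele is principal, then the idele agrees up to local units with a
principal idele. -/
theorem exists_valued_eq_valuation (a : (FiniteAdeleRing R K)ˣ)
    (ha : ClassGroup.mk K (content a) = 1) :
    ∃ x : Kˣ, ∀ v : HeightOneSpectrum R, Valued.v (a.1 v) = v.valuation K (x : K) := by
  obtain ⟨x, hx⟩ := (FractionalIdeal.isPrincipal_iff _).1 (ClassGroup.mk_eq_one_iff.1 ha)
  have hx0 : x ≠ 0 := by
    rintro rfl
    rw [FractionalIdeal.spanSingleton_zero] at hx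
    exact (content a).ne_zero hx
  refine ⟨Units.mk0 x hx0, fun v => ?_⟩
  have h := count_content a v
  rw [hx, ord, ← neg_eq_iff_eq_neg, ← log_valuation_eq_neg_count v hx0] at h
  rw [Units.val_mk0, ← exp_log (x := Valued.v (a.1 v))
    (by simpa using finiteAdele_unit_apply_ne_zero a v), ← h, exp_log (by simpa using hx0)]

end Content

theorem mem_unitGroup_adicCompletionIntegers {R K : Type*} [CommRing R] [IsDedekindDomain R]
    [Field K] [Algebra R K] [IsFractionRing R K] (v : HeightOneSpectrum R)
    (x : (v.adicCompletion K)ˣ) :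
    x ∈ (v.adicCompletionIntegers K).unitGroup ↔ Valued.v (x : v.adicCompletion K) = 1 := by
  rw [ValuationSubring.mem_unitGroup_iff]
  exact (Valuation.isEquiv_valuation_valuationSubring
    (Valued.v : Valuation (v.adicCompletion K) _)).eq_one_iff_eq_one.symm

/-! ### Finite index in the idele group -/

section Ideles

variable (Fq : Type*) [Field Fq] [DecidableEq (RatFunc Fq)]
  (K : Type*) [Field K] [Algebra (RatFunc Fq) K] [Algebra Fq[X] K]
  [IsScalarTower Fq[X] (RatFunc Fq) K] [FunctionField Fq K] [Algebra.IsSeparable (RatFunc Fq) K]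

/-- The ideles that are units at all finite primes. -/
noncomputable def finiteUnits : Subgroup (IdeleGroup Fq K) :=
  ⨅ v : FinitePrime Fq K, (v.adicCompletionIntegers K).unitGroup.comap (finiteComponent v)

/-- The ideal class of the finite part of an idele. -/
noncomputable def ideleClass :
    IdeleGroup Fq K →* ClassGroup (FunctionField.ringOfIntegers Fq K) :=
  (ClassGroup.mk K).comp (content.comp (Units.map (MonoidHom.snd _ _)))

/-- A trivial class yields a principal idele with the same finite valuations; dividing by it leaves
a unit at every finite prime. -/
theorem ker_ideleClass_le :
    (ideleClass Fq K).ker ≤ principalIdeles Fq K ⊔ finiteUnits Fq K := by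
  intro a ha
  obtain ⟨x, hx⟩ := exists_valued_eq_valuation _ ha
  set y : IdeleGroup Fq K := Units.map (algebraMap K (AdeleRing Fq K)).toMonoidHom x with hy
  have hyP : y ∈ principalIdeles Fq K := ⟨x, rfl⟩
  rw [← mul_inv_cancel_left y a]
  refine Subgroup.mul_mem_sup hyP ?_
  rw [finiteUnits, Subgroup.mem_iInf]
  intro v
  rw [Subgroup.mem_comap, mem_unitGroup_adicCompletionIntegers, map_mul, map_inv, Units.val_mul,
    Units.val_inv_eq_inv_val, map_mul, map_inv₀]
  have h1 : Valued.v (finiteComponent v a : v.adicCompletion K) = v.valuation K (x : K) := hx v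
  have h2 : Valued.v (finiteComponent v y : v.adicCompletion K) = v.valuation K (x : K) :=
    v.valuedAdicCompletion_eq_valuation' _
  rw [h1, h2, inv_mul_cancel₀ (by simp)]

theorem finiteIndex_principalIdeles_sup_finiteUnits [Finite Fq] :
    (principalIdeles Fq K ⊔ finiteUnits Fq K).FiniteIndex := by
  have := Fintype.ofFinite Fq
  have := Subgroup.finiteIndex_ker (ideleClass Fq K)
  exact Subgroup.finiteIndex_of_le (ker_ideleClass_le Fq K)

theorem finiteIndex_principalIdeles_sup_deltaUnits [Finite Fq] {n : ℕ}
    (hpow : (powMonoidHom n : (RatFunc.CompletionAtInfty Fq)ˣ →* _).range.FiniteIndex) :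
    (principalIdeles Fq K ⊔ deltaUnits Fq K n).FiniteIndex := by
  set P := principalIdeles Fq K
  set W := finiteUnits Fq K
  set D := deltaUnits Fq K n with hD
  have hDW : D = ((Δ Fq K n).comap (infiniteComponents Fq K)) ⊓ W := rfl
  -- The index of a preimage is the index relative to the image of the map, which divides the full
  -- index.
  have hΔ : ((Δ Fq K n).comap (infiniteComponents Fq K)).index ≠ 0 := by
    rw [Δ, Subgroup.comap_comap, Subgroup.index_comap]
    exact ne_zero_of_dvd_ne_zero hpow.index_ne_zero (Subgroup.relIndex_dvd_index_of_normal _ _)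
  have hrel : (P ⊔ D).relIndex W ≠ 0 := by
    refine ne_zero_of_dvd_ne_zero ?_ (Subgroup.relIndex_dvd_of_le_left W le_sup_right)
    rw [hDW, Subgroup.inf_relIndex_right]
    exact ne_zero_of_dvd_ne_zero hΔ (Subgroup.relIndex_dvd_index_of_normal _ _)
  -- Since `D ≤ W`, the second isomorphism theorem then gives `[PW : PD] = [W : W ∩ PD]`, which is
  -- `hrel`.
  have hsup : W ⊔ (P ⊔ D) = P ⊔ W := by
    rw [sup_left_comm, sup_eq_left.2 (hDW ▸ inf_le_right : D ≤ W)]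
  rw [Subgroup.finiteIndex_iff, ← Subgroup.relIndex_mul_index (sup_le_sup_left
    (hDW ▸ inf_le_right : D ≤ W) P), ← hsup, Subgroup.relIndex_sup_right, hsup]
  exact mul_ne_zero hrel (finiteIndex_principalIdeles_sup_finiteUnits Fq K).index_ne_zero

end Ideles

end KummerFF

/-- `Fq` is the finite field with `q` elements, `k = RatFunc Fq`, and `K / k` is a Kummer extension
of exponent `n`, i.e. a finite abelian extension whose Galois group has exponent `n`, where
`n ∣ q - 1`. The product `Kˣ (Δ × ∏ U_𝔭)` of two subgroups of the abelian group `J_K` is their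
supremum. -/
theorem proposition2p2 (Fq : Type*) [Field Fq] [Finite Fq] [DecidableEq (RatFunc Fq)]
    (K : Type*) [Field K] [Algebra (RatFunc Fq) K]
    [Algebra Fq[X] K] [IsScalarTower Fq[X] (RatFunc Fq) K]
    [FunctionField Fq K] [IsAbelianGalois (RatFunc Fq) K]
    (n : ℕ) (hexp : Monoid.exponent Gal(K/(RatFunc Fq)) = n) (hn : n ∣ Nat.card Fq - 1) :
    (KummerFF.principalIdeles Fq K ⊔ KummerFF.deltaUnits Fq K n).FiniteIndex := by
  exact KummerFF.finiteIndex_principalIdeles_sup_deltaUnits Fq K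
    (KummerFF.finiteIndex_range_powMonoidHom Fq hn)
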